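/- Let $G=\{G(x),x\in\mathbb R\}$ be a real-valued mean-zero Gaussian process with stationary increments and almost surely continuous sample paths, and let $\sigma(h)\ge 0$ be given by $\sigma^2(h)=E(G(x+h)-G(x))^2$ (which does not depend on $x$). Assume that, for some $\delta>0$, $\sigma^2$ is concave and monotonically increasing (not necessarily strictly) on $[0,\delta]$. Let $1\le p<q<\infty$ and suppose that there is a constant $C>0$ such that $\sigma^2(h)\ge C\,h^{1/q}$ for all sufficiently small $h>0$. Put $h_n=1/(\log n)^q$ for $n\ge 2$. Then $$\lim_{n\to\infty}\frac{\sigma(h_n-h_{n+1})}{\sigma(h_{n+1})}=0 .$$ -/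

import Mathlib

open MeasureTheory ProbabilityTheory Filter Topology

/-- A real-valued process indexed by the real line has stationary increments: the
finite-dimensional distributions of the increment process `t ↦ G (x + t) - G x` do not depend on
the base point `x`. -/
def HasStationaryIncrements {Ω : Type*} [MeasurableSpace Ω] (G : ℝ → Ω → ℝ) (P : Measure Ω) :
    Prop :=
  ∀ (x y : ℝ) (I : Finset ℝ),
    IdentDistrib (fun ω (t : I) => G (x + t) ω - G x ω) (fun ω (t : I) => G (y + t) ω - G y ω) P P

/-- `σ(h)`, the nonnegative square root of `σ²(h) = E (G(x+h) - G(x))²`, taken at the base point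
`x = 0`; under stationary increments the base point does not matter, see
`incrementStd_sq_eq`. -/
noncomputable def incrementStd {Ω : Type*} [MeasurableSpace Ω] (G : ℝ → Ω → ℝ) (P : Measure Ω)
    (h : ℝ) : ℝ :=
  √(∫ ω, (G (0 + h) ω - G 0 ω) ^ 2 ∂P)

theorem incrementStd_sq_eq {Ω : Type*} [MeasurableSpace Ω] {G : ℝ → Ω → ℝ} {P : Measure Ω}
    (hG : HasStationaryIncrements G P) (x h : ℝ) :
    incrementStd G P h ^ 2 = ∫ ω, (G (x + h) ω - G x ω) ^ 2 ∂P := by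
  unfold incrementStd
  rw [Real.sq_sqrt (integral_nonneg fun ω => sq_nonneg _)]
  have hI := hG 0 x {h}
  have hu : Measurable (fun v : ({h} : Finset ℝ) → ℝ => v ⟨h, Finset.mem_singleton_self h⟩ ^ 2) := by
    fun_prop
  exact (hI.comp hu).integral_eq

/-- The sequence `h_n = 1 / (log n)^q` (meaningful for `n ≥ 2`). -/
noncomputable def logSeq (q : ℝ) (n : ℕ) : ℝ := 1 / Real.log n ^ q

/-!
Sample continuity forces `σ²(h) * log (1 / h) → 0` as `h → 0+`. Since
`h_n - h_{n+1} ≤ q / n`, this gives `σ²(h_n - h_{n+1}) = o(1 / log n)`, whereas the lower bound on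
`σ²` gives `σ²(h_{n+1}) ≥ C / log (n + 1)`, so the ratio tends to `0`.

The decay of `σ²` (`tendsto_incrementStd_sq_mul_log_inv`) is usually deduced from Sudakov's
minoration. Here a second-moment argument suffices. Cut `[0, δ]` into `N = ⌊δ / h⌋` intervals of
length `h`, and let `X_0, …, X_{N-1}` be the increments of `G` over them. Concavity of `σ²` makes
them negatively correlated (`integral_add_increments_sq_le`), so for every `t` the variables
`exp (t * X_i)` are negatively correlated as well, and their sum `S` satisfies
`Var S ≤ N * exp (2 * t² * σ²(h))` (`variance_sum_exp_le`). By Chebyshev's inequality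
`S ≥ E S / 2 = N * exp (t² * σ²(h) / 2) / 2` with probability close to `1` when
`t² * σ²(h) = log N / 2`. Uniform continuity on `[0, δ]` gives `X_i ≤ ε` for all `i`, and thus
`S ≤ N * exp (t * ε)`, with probability more than `1 / 2` once `h` is small. Comparing the two bounds
at a common sample point yields `σ²(h) * log N ≤ 32 * ε²` (`mul_log_le_of_measure_forall_le`).
-/

/-! ### Exponential sums of negatively correlated Gaussian variables -/

section Centered
variable {Ω : Type*} [MeasurableSpace Ω] {P : Measure Ω}

theorem integrable_exp_mul_of_hasGaussianLaw {Z : Ω → ℝ} (hZ : HasGaussianLaw Z P) (t : ℝ) :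
    Integrable (fun ω => Real.exp (t * Z ω)) P := by
  have := hZ.isProbabilityMeasure
  rw [← mgf_pos_iff, mgf_gaussianReal hZ.map_eq_gaussianReal]
  positivity

theorem integral_exp_mul_of_hasGaussianLaw {Z : Ω → ℝ} (hZ : HasGaussianLaw Z P)
    (h0 : ∫ ω, Z ω ∂P = 0) (t : ℝ) :
    ∫ ω, Real.exp (t * Z ω) ∂P = Real.exp (t ^ 2 * (∫ ω, Z ω ^ 2 ∂P) / 2) := by
  have h := mgf_gaussianReal hZ.map_eq_gaussianReal t
  rw [mgf, h0, Real.coe_toNNReal _ (variance_nonneg _ _),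
    variance_of_integral_eq_zero hZ.aemeasurable h0] at h
  rw [h]
  ring_nf

theorem memLp_two_exp_mul_of_hasGaussianLaw {Z : Ω → ℝ} (hZ : HasGaussianLaw Z P) (t : ℝ) :
    MemLp (fun ω => Real.exp (t * Z ω)) 2 P := by
  rw [memLp_two_iff_integrable_sq (integrable_exp_mul_of_hasGaussianLaw hZ t).1]
  refine (integrable_exp_mul_of_hasGaussianLaw hZ (2 * t)).congr (.of_forall fun ω => ?_)
  simp only [← Real.exp_nat_mul]
  push_cast
  ring_nf

/-- Off the diagonal the exponentials are negatively correlated as soon as the variables are,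
so only the diagonal contributes. -/
theorem variance_sum_exp_le {X : ℕ → Ω → ℝ} (hX : IsGaussianProcess X P)
    (h0 : ∀ i, ∫ ω, X i ω ∂P = 0) {v : ℝ} {N : ℕ} (hv : ∀ i, ∫ ω, X i ω ^ 2 ∂P = v)
    (hneg : ∀ i < N, ∀ j < N, i ≠ j → ∫ ω, (X i ω + X j ω) ^ 2 ∂P ≤ 2 * v) (t : ℝ) :
    Var[fun ω => ∑ i ∈ Finset.range N, Real.exp (t * X i ω); P] ≤
      N * Real.exp (2 * t ^ 2 * v) := by
  classical
  have := hX.isProbabilityMeasure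
  have hL := fun i => memLp_two_exp_mul_of_hasGaussianLaw (hX.hasGaussianLaw_eval i) t
  rw [variance_fun_sum' fun i _ => hL i]
  calc _ ≤ ∑ i ∈ Finset.range N, ∑ j ∈ Finset.range N,
        if i = j then Real.exp (2 * t ^ 2 * v) else 0 := by
        refine Finset.sum_le_sum fun i hi => Finset.sum_le_sum fun j hj => ?_
        rw [Finset.mem_range] at hi hj
        have hprod : ∫ ω, Real.exp (t * X i ω) * Real.exp (t * X j ω) ∂P
            = Real.exp (t ^ 2 * (∫ ω, (X i ω + X j ω) ^ 2 ∂P) / 2) := by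
          have hs : ∫ ω, (X i ω + X j ω) ∂P = 0 := by
            rw [integral_add (hX.hasGaussianLaw_eval i).integrable
              (hX.hasGaussianLaw_eval j).integrable, h0, h0, add_zero]
          rw [← integral_exp_mul_of_hasGaussianLaw hX.hasGaussianLaw_fun_add hs]
          simp_rw [← Real.exp_add, mul_add]
        have hmean := fun i => integral_exp_mul_of_hasGaussianLaw (hX.hasGaussianLaw_eval i) (h0 i) t
        rw [covariance_eq_sub (hL i) (hL j)]
        simp only [Pi.mul_apply]
        rw [hprod, hmean, hmean, hv, hv, ← Real.exp_add]
        split_ifs with h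
        · subst h
          have : ∫ ω, (X i ω + X i ω) ^ 2 ∂P = 4 * v := by
            rw [← hv i, ← integral_const_mul]
            congr 1 with ω
            ring
          rw [this, show t ^ 2 * (4 * v) / 2 = 2 * t ^ 2 * v by ring]
          exact sub_le_self _ (Real.exp_pos _).le
        · rw [sub_nonpos, Real.exp_le_exp]
          nlinarith [mul_le_mul_of_nonneg_left (hneg i hi j hj h) (sq_nonneg t)]
    _ = _ := by simp +contextual

/-- Chebyshev's inequality; `N * exp (t ^ 2 * v / 2)` is the mean of the sum. -/
theorem measure_sum_exp_lt_half_le {X : ℕ → Ω → ℝ} (hX : IsGaussianProcess X P)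
    (h0 : ∀ i, ∫ ω, X i ω ∂P = 0) {v : ℝ} {N : ℕ} (hN : 0 < N)
    (hv : ∀ i, ∫ ω, X i ω ^ 2 ∂P = v)
    (hneg : ∀ i < N, ∀ j < N, i ≠ j → ∫ ω, (X i ω + X j ω) ^ 2 ∂P ≤ 2 * v) (t : ℝ) :
    P {ω | ∑ i ∈ Finset.range N, Real.exp (t * X i ω) < N * Real.exp (t ^ 2 * v / 2) / 2} ≤
      ENNReal.ofReal (4 * Real.exp (t ^ 2 * v) / N) := by
  have := hX.isProbabilityMeasure
  have hNpos : (0 : ℝ) < N := by exact_mod_cast hN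
  have hL : MemLp (fun ω => ∑ i ∈ Finset.range N, Real.exp (t * X i ω)) 2 P :=
    memLp_finsetSum _ fun i _ => memLp_two_exp_mul_of_hasGaussianLaw (hX.hasGaussianLaw_eval i) t
  have hmean : ∫ ω, ∑ i ∈ Finset.range N, Real.exp (t * X i ω) ∂P =
      N * Real.exp (t ^ 2 * v / 2) := by
    rw [integral_finsetSum _ fun i _ =>
      integrable_exp_mul_of_hasGaussianLaw (hX.hasGaussianLaw_eval i) t]
    simp_rw [fun i => integral_exp_mul_of_hasGaussianLaw (hX.hasGaussianLaw_eval i) (h0 i) t, hv]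
    simp
  refine (measure_mono fun ω hω => ?_).trans
    ((meas_ge_le_variance_div_sq hL
      (c := N * Real.exp (t ^ 2 * v / 2) / 2) (by positivity)).trans (ENNReal.ofReal_le_ofReal ?_))
  · simp only [Set.mem_ofPred_eq, hmean] at hω ⊢
    rw [abs_sub_comm]
    exact le_trans (by linarith) (le_abs_self _)
  · have he : Real.exp (t ^ 2 * v / 2) ^ 2 = Real.exp (t ^ 2 * v) := by
      rw [← Real.exp_nat_mul]; push_cast; ring_nf
    have he2 : Real.exp (2 * t ^ 2 * v) = Real.exp (t ^ 2 * v) ^ 2 := by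
      rw [← Real.exp_nat_mul]; push_cast; ring_nf
    rw [div_le_iff₀ (by positivity)]
    refine (variance_sum_exp_le hX h0 hv hneg t).trans (le_of_eq ?_)
    rw [he2, div_pow, mul_pow, he]
    field_simp
    norm_num

end Centered

section Small
variable {Ω : Type*} [MeasurableSpace Ω] {P : Measure Ω}

/-- A substitute for Sudakov's minoration: negatively correlated centred Gaussian variables cannot
all stay below `ε` with probability more than `1 / 2` unless their variance is of order at most
`ε ^ 2 / log N`. The event need not be measurable. -/
theorem mul_log_le_of_measure_forall_le {X : ℕ → Ω → ℝ} (hX : IsGaussianProcess X P)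
    (h0 : ∀ i, ∫ ω, X i ω ∂P = 0) {v ε : ℝ} {N : ℕ} (hN : 256 ≤ N)
    (hv : ∀ i, ∫ ω, X i ω ^ 2 ∂P = v)
    (hneg : ∀ i < N, ∀ j < N, i ≠ j → ∫ ω, (X i ω + X j ω) ^ 2 ∂P ≤ 2 * v)
    (hP : 1 / 2 < P {ω | ∀ i < N, X i ω ≤ ε}) : v * Real.log N ≤ 32 * ε ^ 2 := by
  have hv0 : 0 ≤ v := by
    rw [← hv 0]
    exact integral_nonneg fun ω => sq_nonneg _
  rcases hv0.eq_or_lt with rfl | hvpos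
  · rw [zero_mul]; positivity
  have hNr : (256 : ℝ) ≤ N := by exact_mod_cast hN
  have hNpos : (0 : ℝ) < N := by linarith
  set L := Real.log N / 2 with hL
  have hLN : Real.log N = 2 * L := by rw [hL]; ring
  have hL2 : 4 * Real.log 2 ≤ L := by
    have h := Real.log_le_log (by norm_num) hNr
    rw [show (256 : ℝ) = 2 ^ 8 by norm_num, Real.log_pow] at h
    push_cast at h
    linarith
  have hLpos : 0 < L := by
    have := Real.log_pos one_lt_two
    linarith
  -- With this `t` the factor `exp (t ^ 2 * v)` in Chebyshev's bound is `√N`.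
  set t := √(L / v) with ht
  have ht2 : t ^ 2 * v = L := by
    rw [ht, Real.sq_sqrt (by positivity)]
    field_simp
  have hprob := measure_sum_exp_lt_half_le hX h0 (by omega : 0 < N) hv hneg t
  rw [ht2] at hprob
  have hsmall : 4 * Real.exp L / N ≤ 1 / 2 := by
    have h1 : (N : ℝ) = Real.exp L * Real.exp L := by
      rw [← Real.exp_add, ← two_mul, ← hLN, Real.exp_log hNpos]
    have h2 : (16 : ℝ) ≤ Real.exp L := by
      by_contra h
      nlinarith [Real.exp_pos L]
    rw [div_le_iff₀ hNpos]
    nlinarith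
  -- The two events have total probability more than `1`, so they meet.
  obtain ⟨ω, hωA, hωS⟩ : ∃ ω, (∀ i < N, X i ω ≤ ε) ∧
      N * Real.exp (L / 2) / 2 ≤ ∑ i ∈ Finset.range N, Real.exp (t * X i ω) := by
    by_contra! h
    have : P {ω | ∀ i < N, X i ω ≤ ε} ≤ ENNReal.ofReal (1 / 2) :=
      (measure_mono h).trans (hprob.trans (ENNReal.ofReal_le_ofReal hsmall))
    refine absurd hP (not_lt.2 (this.trans (le_of_eq ?_)))
    rw [ENNReal.ofReal_div_of_pos two_pos]
    simp
  have hup : ∑ i ∈ Finset.range N, Real.exp (t * X i ω) ≤ N * Real.exp (t * ε) := by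
    refine (Finset.sum_le_card_nsmul _ _ (Real.exp (t * ε)) fun i hi => ?_).trans (by simp)
    exact Real.exp_le_exp.2
      (mul_le_mul_of_nonneg_left (hωA i (Finset.mem_range.1 hi)) (Real.sqrt_nonneg _))
  have hcmp : Real.exp (L / 2) ≤ Real.exp (t * ε + Real.log 2) := by
    rw [Real.exp_add, Real.exp_log two_pos]
    have := hωS.trans hup
    have : (N : ℝ) * Real.exp (L / 2) ≤ N * (Real.exp (t * ε) * 2) := by linarith
    exact le_of_mul_le_mul_left this hNpos
  rw [Real.exp_le_exp] at hcmp
  have h4 : L / 4 ≤ t * ε := by linarith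
  have hsq : (L / 4) ^ 2 ≤ (t * ε) ^ 2 := pow_le_pow_left₀ (by positivity) h4 2
  have : L * (v * L) ≤ L * (16 * ε ^ 2) := by
    calc L * (v * L) = 16 * v * (L / 4) ^ 2 := by ring
      _ ≤ 16 * v * (t * ε) ^ 2 := by gcongr
      _ = (t ^ 2 * v) * (16 * ε ^ 2) := by ring
      _ = _ := by rw [ht2]
  have := le_of_mul_le_mul_left this hLpos
  rw [hLN]
  linarith

/-- The event need not be measurable: monotone unions are continuous from below for the outer
measure. -/
theorem exists_half_lt_measure_modulus_le {G : ℝ → Ω → ℝ} [IsProbabilityMeasure P]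
    (hcont : ∀ᵐ ω ∂P, Continuous fun x : ℝ => G x ω) (δ : ℝ) {ε : ℝ} (hε : 0 < ε) :
    ∃ η > 0, 1 / 2 < P {ω | ∀ s ∈ Set.Icc 0 δ, ∀ u ∈ Set.Icc 0 δ, |s - u| ≤ η →
      |G s ω - G u ω| ≤ ε} := by
  set A : ℕ → Set Ω := fun m => {ω | ∀ s ∈ Set.Icc 0 δ, ∀ u ∈ Set.Icc 0 δ,
    |s - u| ≤ 1 / ((m : ℝ) + 1) → |G s ω - G u ω| ≤ ε} with hA
  have hmono : Monotone A := fun m n hmn ω hω s hs u hu hsu =>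
    hω s hs u hu (hsu.trans (by gcongr))
  have hfull : P (⋃ m, A m) = 1 := by
    rw [← measure_univ (μ := P)]
    refine measure_congr (eventuallyEq_univ.2 ?_)
    filter_upwards [hcont] with ω hω
    have hu := isCompact_Icc.uniformContinuousOn_of_continuous
      (hω.continuousOn (s := Set.Icc 0 δ))
    obtain ⟨η, hη, h⟩ := Metric.uniformContinuousOn_iff.1 hu ε hε
    obtain ⟨m, hm⟩ := exists_nat_one_div_lt hη
    refine Set.mem_iUnion.2 ⟨m, fun s hs u hu hsu => (h s hs u hu ?_).le⟩
    exact (hsu.trans_lt hm)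
  have hlim := tendsto_measure_iUnion_atTop (μ := P) hmono
  rw [hfull] at hlim
  obtain ⟨m, hm⟩ := (hlim.eventually (lt_mem_nhds (a := 1 / 2) (by simp))).exists
  exact ⟨1 / ((m : ℝ) + 1), by positivity, hm⟩

end Small

/-! ### Increments of the process -/

section Increments
variable {Ω : Type*} [MeasurableSpace Ω] {P : Measure Ω} {G : ℝ → Ω → ℝ}

theorem integral_sub_sq_eq_incrementStd_sq (hstat : HasStationaryIncrements G P) {a b h : ℝ}
    (hab : b - a = h) : ∫ ω, (G b ω - G a ω) ^ 2 ∂P = incrementStd G P h ^ 2 := by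
  rw [incrementStd_sq_eq hstat a h, ← hab, add_sub_cancel]

theorem isGaussianProcess_increments (hG : IsGaussianProcess G P) (h : ℝ) :
    IsGaussianProcess (fun (k : ℕ) ω => G ((k + 1) * h) ω - G (k * h) ω) P := by
  classical
  refine hG.of_isGaussianProcess fun k => ⟨{((k : ℝ) + 1) * h, (k : ℝ) * h},
    ContinuousLinearMap.proj (R := ℝ) ⟨((k : ℝ) + 1) * h, by simp⟩ -
      ContinuousLinearMap.proj (R := ℝ) ⟨(k : ℝ) * h, by simp⟩, fun ω => ?_⟩
  simp

/-- The inequality says that increments over disjoint intervals are negatively correlated: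
`2 * (b - a) * (d - c) = (d - a) ^ 2 + (c - b) ^ 2 - (c - a) ^ 2 - (d - b) ^ 2`, so the covariance
is a second difference of the concave function `σ ^ 2`. -/
theorem integral_add_increments_sq_le (hG : IsGaussianProcess G P)
    (hstat : HasStationaryIncrements G P) {δ : ℝ}
    (hconc : ConcaveOn ℝ (Set.Icc 0 δ) fun h => incrementStd G P h ^ 2) {h : ℝ} (hh : 0 ≤ h)
    {i j : ℕ} (hij : i < j) (hj : (j + 1) * h ≤ δ) :
    ∫ ω, ((G ((i + 1) * h) ω - G (i * h) ω) + (G ((j + 1) * h) ω - G (j * h) ω)) ^ 2 ∂P ≤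
      2 * incrementStd G P h ^ 2 := by
  have hint : ∀ x y, Integrable (fun ω => (G x ω - G y ω) ^ 2) P := fun x y =>
    (hG.hasGaussianLaw_fun_sub (s := x) (t := y)).memLp_two.integrable_sq
  set a := (i : ℝ) * h with ha
  set b := ((i : ℝ) + 1) * h with hb
  set c := (j : ℝ) * h with hc
  set d := ((j : ℝ) + 1) * h with hd
  have hexp : ∫ ω, ((G b ω - G a ω) + (G d ω - G c ω)) ^ 2 ∂P =
      ∫ ω, (G b ω - G a ω) ^ 2 ∂P + ∫ ω, (G d ω - G c ω) ^ 2 ∂P + ∫ ω, (G d ω - G a ω) ^ 2 ∂P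
        + ∫ ω, (G c ω - G b ω) ^ 2 ∂P - ∫ ω, (G c ω - G a ω) ^ 2 ∂P
        - ∫ ω, (G d ω - G b ω) ^ 2 ∂P := by
    have h1 := (hint b a).add (hint d c)
    have h2 := h1.add (hint d a)
    have h3 := h2.add (hint c b)
    have h4 := h3.sub (hint c a)
    rw [← integral_add' (hint b a) (hint d c), ← integral_add' h1 (hint d a),
      ← integral_add' h2 (hint c b), ← integral_sub' h3 (hint c a), ← integral_sub' h4 (hint d b)]
    congr 1 with ω
    simp only [Pi.add_apply, Pi.sub_apply]
    ring
  have hij' : (i : ℝ) + 1 ≤ j := by exact_mod_cast hij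
  have hi0 : (0 : ℝ) ≤ i := i.cast_nonneg
  rw [hexp, integral_sub_sq_eq_incrementStd_sq hstat (h := h) (by rw [ha, hb]; ring),
    integral_sub_sq_eq_incrementStd_sq hstat (h := h) (by rw [hc, hd]; ring),
    integral_sub_sq_eq_incrementStd_sq hstat (h := (j - i + 1) * h) (by rw [ha, hd]; ring),
    integral_sub_sq_eq_incrementStd_sq hstat (h := (j - i - 1) * h) (by rw [hb, hc]; ring),
    integral_sub_sq_eq_incrementStd_sq hstat (h := (j - i) * h) (by rw [ha, hc]; ring),
    integral_sub_sq_eq_incrementStd_sq hstat (h := (j - i) * h) (by rw [hb, hd]; ring)]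
  have hle : ((j : ℝ) - i + 1) * h ≤ δ := (by nlinarith : _ ≤ d).trans hj
  have hm : ((j : ℝ) - i - 1) * h ∈ Set.Icc 0 δ :=
    ⟨mul_nonneg (by linarith) hh, by nlinarith⟩
  have hp : ((j : ℝ) - i + 1) * h ∈ Set.Icc 0 δ := ⟨mul_nonneg (by linarith) hh, hle⟩
  have hmid := hconc.2 hp hm (by norm_num : (0 : ℝ) ≤ 1 / 2) (by norm_num : (0 : ℝ) ≤ 1 / 2)
    (by norm_num)
  simp only [smul_eq_mul] at hmid
  rw [show (1 / 2 : ℝ) * ((j - i + 1) * h) + 1 / 2 * ((j - i - 1) * h) = (j - i) * h by ring]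
    at hmid
  linarith

end Increments

/-! ### Decay of the increment variance -/

section Modulus
variable {Ω : Type*} [MeasurableSpace Ω] {P : Measure Ω} {G : ℝ → Ω → ℝ}

theorem incrementStd_sq_mul_log_floor_le (hG : IsGaussianProcess G P)
    (hmean : ∀ x : ℝ, ∫ ω, G x ω ∂P = 0) (hstat : HasStationaryIncrements G P) {δ : ℝ}
    (hconc : ConcaveOn ℝ (Set.Icc 0 δ) fun h => incrementStd G P h ^ 2) {ε η h : ℝ}
    (hmod : 1 / 2 < P {ω | ∀ s ∈ Set.Icc 0 δ, ∀ u ∈ Set.Icc 0 δ, |s - u| ≤ η →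
      |G s ω - G u ω| ≤ ε})
    (hh : 0 < h) (hη : h ≤ η) (hhδ : 256 * h ≤ δ) :
    incrementStd G P h ^ 2 * Real.log ⌊δ / h⌋₊ ≤ 32 * ε ^ 2 := by
  set N := ⌊δ / h⌋₊ with hNdef
  have hN : 256 ≤ N := Nat.le_floor (by rw [le_div_iff₀ hh]; exact_mod_cast hhδ)
  have hNh : (N : ℝ) * h ≤ δ := by
    rw [← le_div_iff₀ hh]
    exact Nat.floor_le (div_nonneg (by linarith) hh.le)
  have hle : ∀ i < N, ((i : ℝ) + 1) * h ≤ δ := fun i hi =>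
    (mul_le_mul_of_nonneg_right (by exact_mod_cast hi) hh.le).trans hNh
  refine mul_log_le_of_measure_forall_le (isGaussianProcess_increments hG h) (fun i => ?_) hN
    (fun i => integral_sub_sq_eq_incrementStd_sq hstat (by ring)) (fun i hi j hj hij => ?_)
    (hmod.trans_le (measure_mono fun ω hω i hi => ?_))
  · rw [integral_sub (hG.hasGaussianLaw_eval _).integrable (hG.hasGaussianLaw_eval _).integrable,
      hmean, hmean, sub_zero]
  · rcases lt_or_gt_of_ne hij with hlt | hlt
    · exact integral_add_increments_sq_le hG hstat hconc hh.le hlt (hle j hj)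
    · simp_rw [add_comm (G (((i : ℝ) + 1) * h) _ - G (i * h) _)]
      exact integral_add_increments_sq_le hG hstat hconc hh.le hlt (hle i hi)
  · have h0 : 0 ≤ (i : ℝ) * h := by positivity
    have h1 := hle i hi
    refine (le_abs_self _).trans
      (hω _ ⟨by positivity, h1⟩ _ ⟨h0, by linarith⟩ ?_)
    rw [show ((i : ℝ) + 1) * h - i * h = h by ring, abs_of_pos hh]
    exact hη

/-- Sample continuity forces `σ ^ 2` to decay faster than `1 / log (1 / h)`. -/
theorem tendsto_incrementStd_sq_mul_log_inv [IsProbabilityMeasure P] (hG : IsGaussianProcess G P)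
    (hmean : ∀ x : ℝ, ∫ ω, G x ω ∂P = 0) (hstat : HasStationaryIncrements G P)
    (hcont : ∀ᵐ ω ∂P, Continuous fun x : ℝ => G x ω) {δ : ℝ} (hδ : 0 < δ)
    (hconc : ConcaveOn ℝ (Set.Icc 0 δ) fun h => incrementStd G P h ^ 2) :
    Tendsto (fun h => incrementStd G P h ^ 2 * Real.log h⁻¹) (𝓝[>] 0) (𝓝 0) := by
  rw [Metric.tendsto_nhds]
  intro e he
  obtain ⟨η, hη, hmod⟩ := exists_half_lt_measure_modulus_le hcont δ
    (Real.sqrt_pos.2 (by positivity : 0 < e / 128))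
  have hlt : ∀ {a : ℝ}, 0 < a → ∀ᶠ h in 𝓝[>] (0 : ℝ), h < a := fun ha =>
    (eventually_lt_nhds ha).filter_mono nhdsWithin_le_nhds
  filter_upwards [self_mem_nhdsWithin, hlt hη, hlt (by positivity : 0 < δ / 256), hlt one_pos,
    hlt (by positivity : 0 < (δ / 2) ^ 2)] with h hh h1 h2 h3 h4
  replace hh : 0 < h := hh
  have hkey := incrementStd_sq_mul_log_floor_le hG hmean hstat hconc hmod hh h1.le (by linarith)
  rw [Real.sq_sqrt (by positivity)] at hkey
  -- The number of intervals is at least `δ / (2 * h)`, hence at least `h ^ (-1 / 2)`.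
  have hfl : δ / 2 / h ≤ ⌊δ / h⌋₊ := by
    have hge : 2 ≤ δ / h := by rw [le_div_iff₀ hh]; linarith
    have := Nat.lt_floor_add_one (δ / h)
    rw [div_right_comm]
    linarith
  have hlogN := Real.log_le_log (by positivity) hfl
  rw [Real.log_div (by positivity) hh.ne'] at hlogN
  have hlogh := Real.log_le_log hh h4.le
  rw [Real.log_pow] at hlogh
  push_cast at hlogh
  have hneg := Real.log_neg hh h3
  have hsq := sq_nonneg (incrementStd G P h)
  rw [Real.log_inv, Real.dist_eq, sub_zero, abs_of_nonneg (mul_nonneg hsq (by linarith))]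
  have := mul_le_mul_of_nonneg_left (by linarith : -Real.log h / 2 ≤ Real.log ⌊δ / h⌋₊) hsq
  linarith

end Modulus

/-! ### The sequence `1 / (log n) ^ q` -/

section LogSeq

theorem logSeq_pos {q : ℝ} {n : ℕ} (hn : 2 ≤ n) : 0 < logSeq q n := by
  have : 0 < Real.log n := Real.log_pos (by exact_mod_cast hn)
  unfold logSeq
  positivity

theorem tendsto_logSeq {q : ℝ} (hq : 0 < q) : Tendsto (logSeq q) atTop (𝓝 0) := by
  have h := ((tendsto_rpow_atTop hq).comp
    (Real.tendsto_log_atTop.comp tendsto_natCast_atTop_atTop)).inv_tendsto_atTop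
  exact h.congr fun n => by simp [logSeq]

theorem logSeq_rpow_inv {q : ℝ} (hq : 0 < q) (n : ℕ) :
    logSeq q n ^ (1 / q) = (Real.log n)⁻¹ := by
  have h0 : 0 ≤ Real.log n := Real.log_natCast_nonneg n
  rw [logSeq, one_div, one_div, Real.inv_rpow (by positivity), Real.rpow_rpow_inv h0 hq.ne']

theorem logSeq_sub_succ_pos {q : ℝ} (hq : 0 < q) {n : ℕ} (hn : 2 ≤ n) :
    0 < logSeq q n - logSeq q (n + 1) := by
  have hn' : (2 : ℝ) ≤ n := by exact_mod_cast hn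
  have h0 : 0 < Real.log n := Real.log_pos (by linarith)
  have h1 : Real.log n < Real.log (n + 1 : ℕ) := Real.log_lt_log (by linarith) (by simp)
  rw [sub_pos]
  exact one_div_lt_one_div_of_lt (by positivity) (Real.rpow_lt_rpow h0.le h1 hq)

theorem logSeq_sub_succ_le {q : ℝ} (hq : 1 ≤ q) {n : ℕ} (hn : 3 ≤ n) :
    logSeq q n - logSeq q (n + 1) ≤ q / n := by
  have hn' : (3 : ℝ) ≤ n := by exact_mod_cast hn
  have hnpos : (0 : ℝ) < n := by linarith
  set a := Real.log n with ha
  set b := Real.log (n + 1 : ℕ) with hb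
  have ha1 : 1 ≤ a := by
    rw [ha, Real.le_log_iff_exp_le hnpos]
    exact Real.exp_one_lt_three.le.trans hn'
  have hab : a ≤ b := Real.log_le_log hnpos (by simp)
  have hb1 : 1 ≤ b := ha1.trans hab
  have hba : b - a ≤ 1 / n := by
    rw [ha, hb, ← Real.log_div (by positivity) hnpos.ne']
    refine (Real.log_le_sub_one_of_pos (by positivity)).trans (le_of_eq ?_)
    push_cast
    field_simp
    ring
  -- Bernoulli: `(a / b) ^ q ≥ 1 + q * (a / b - 1)`.
  have hbern := one_add_mul_self_le_rpow_one_add (s := a / b - 1) (by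
    have : 0 ≤ a / b := by positivity
    linarith) hq
  rw [add_sub_cancel, Real.div_rpow (by linarith) (by linarith)] at hbern
  have haq : 1 ≤ a ^ q := Real.one_le_rpow ha1 (by linarith)
  have hfac : logSeq q n - logSeq q (n + 1) = (1 - a ^ q / b ^ q) / a ^ q := by
    have : 0 < b ^ q := by positivity
    simp only [logSeq, ← ha, ← hb]
    field_simp
  have hbd : (b - a) / b ≤ 1 / n := (div_le_self (by linarith) hb1).trans hba
  have hba' : 1 - a / b = (b - a) / b := by field_simp
  calc logSeq q n - logSeq q (n + 1) = (1 - a ^ q / b ^ q) / a ^ q := hfac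
    _ ≤ (q * ((b - a) / b)) / a ^ q := by
        gcongr
        rw [← hba']
        linarith
    _ ≤ q * ((b - a) / b) :=
        div_le_self (mul_nonneg (by linarith) (div_nonneg (by linarith) (by linarith))) haq
    _ ≤ q * (1 / n) := by gcongr
    _ = q / n := by ring

theorem log_succ_le_two_mul_log_inv_logSeq_sub_succ {q : ℝ} (hq : 1 ≤ q) {n : ℕ} (hn : 3 ≤ n)
    (hnq : 2 * q ^ 2 ≤ n) :
    Real.log (n + 1 : ℕ) ≤ 2 * Real.log (logSeq q n - logSeq q (n + 1))⁻¹ := by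
  have hn' : (3 : ℝ) ≤ n := by exact_mod_cast hn
  have hd := logSeq_sub_succ_pos (by linarith : 0 < q) (by omega : 2 ≤ n)
  have hinv : n / q ≤ (logSeq q n - logSeq q (n + 1))⁻¹ := by
    rw [← inv_div]
    exact inv_anti₀ hd (logSeq_sub_succ_le hq hn)
  have hsq : ((n + 1 : ℕ) : ℝ) ≤ (n / q) ^ 2 := by
    rw [div_pow, le_div_iff₀ (by positivity)]
    push_cast
    nlinarith [sq_nonneg q]
  have h1 := Real.log_le_log (by positivity) hsq
  rw [Real.log_pow] at h1
  push_cast at h1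
  have h2 := Real.log_le_log (by positivity) hinv
  push_cast
  linarith

end LogSeq

/-! ### The ratio of consecutive scales -/

theorem lemma2p2 {Ω : Type*} [MeasurableSpace Ω] (P : Measure Ω) [IsProbabilityMeasure P]
    (G : ℝ → Ω → ℝ)
    (hGauss : IsGaussianProcess G P)
    (hmean : ∀ x : ℝ, ∫ ω, G x ω ∂P = 0)
    (hstat : HasStationaryIncrements G P)
    (hcont : ∀ᵐ ω ∂P, Continuous fun x : ℝ => G x ω)
    (δ : ℝ) (hδ : 0 < δ)
    (hconc : ConcaveOn ℝ (Set.Icc 0 δ) fun h => incrementStd G P h ^ 2)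
    (hmono : MonotoneOn (fun h => incrementStd G P h ^ 2) (Set.Icc 0 δ))
    (p q C : ℝ) (hp : 1 ≤ p) (hq : p < q) (hC : 0 < C)
    (hlow : ∀ᶠ h in 𝓝[>] (0 : ℝ), C * h ^ (1 / q) ≤ incrementStd G P h ^ 2) :
    Tendsto
      (fun n : ℕ => incrementStd G P (logSeq q n - logSeq q (n + 1)) /
        incrementStd G P (logSeq q (n + 1)))
      atTop (𝓝 0) := by
  have hq1 : 1 ≤ q := hp.trans hq.le
  have hq0 : 0 < q := by linarith
  have hsucc : Tendsto (fun n : ℕ => logSeq q (n + 1)) atTop (𝓝[>] 0) := by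
    refine tendsto_nhdsWithin_iff.2
      ⟨(tendsto_logSeq hq0).comp (tendsto_add_atTop_nat 1), ?_⟩
    filter_upwards [eventually_ge_atTop 2] with n hn
    exact logSeq_pos (by omega)
  have hdiff : Tendsto (fun n : ℕ => logSeq q n - logSeq q (n + 1)) atTop (𝓝[>] 0) := by
    refine tendsto_nhdsWithin_iff.2 ⟨?_, ?_⟩
    · simpa using (tendsto_logSeq hq0).sub (tendsto_nhdsWithin_iff.1 hsucc).1
    · filter_upwards [eventually_ge_atTop 2] with n hn
      exact logSeq_sub_succ_pos hq0 hn
  have hmod := ((tendsto_incrementStd_sq_mul_log_inv hGauss hmean hstat hcont hδ hconc).comp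
    hdiff).const_mul (2 / C)
  rw [mul_zero] at hmod
  have hsq : Tendsto (fun n : ℕ => (incrementStd G P (logSeq q n - logSeq q (n + 1)) /
      incrementStd G P (logSeq q (n + 1))) ^ 2) atTop (𝓝 0) := by
    refine tendsto_of_tendsto_of_tendsto_of_le_of_le' tendsto_const_nhds hmod
      (.of_forall fun n => sq_nonneg _) ?_
    filter_upwards [hsucc.eventually hlow, eventually_ge_atTop 3,
      tendsto_natCast_atTop_atTop.eventually_ge_atTop (2 * q ^ 2)] with n hn h3 hnq
    have hlogpos : 0 < Real.log (n + 1 : ℕ) :=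
      Real.log_pos (by exact_mod_cast (by omega : 1 < n + 1))
    rw [logSeq_rpow_inv hq0, ← div_eq_mul_inv] at hn
    have hlog := log_succ_le_two_mul_log_inv_logSeq_sub_succ hq1 h3 hnq
    set d := logSeq q n - logSeq q (n + 1)
    simp only [Function.comp_apply, div_pow]
    calc incrementStd G P d ^ 2 / incrementStd G P (logSeq q (n + 1)) ^ 2
        ≤ incrementStd G P d ^ 2 / (C / Real.log (n + 1 : ℕ)) := by gcongr
      _ = incrementStd G P d ^ 2 * Real.log (n + 1 : ℕ) / C := by field_simp
      _ ≤ incrementStd G P d ^ 2 * (2 * Real.log d⁻¹) / C := by gcongr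
      _ = 2 / C * (incrementStd G P d ^ 2 * Real.log d⁻¹) := by ring
  have := hsq.sqrt
  rw [Real.sqrt_zero] at this
  exact this.congr fun n =>
    Real.sqrt_sq (div_nonneg (Real.sqrt_nonneg _) (Real.sqrt_nonneg _))
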